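/- Let $1\le k\le n$. Consider $n$ nodes, each with an unbounded first-come-first-served queue. Jobs $j=0,1,2,\dots$ arrive one after the other at an initially empty system (with arbitrary random non-negative inter-arrival times), and job $j$ sends one sub-task to every node $i$, with random service time $S_j^i\ge 0$. No independence is assumed; the nodes are homogeneous, i.e. the joint law of the arrival process and of all service times is invariant under permutations of the nodes. In the basic $(n,n)$ queue the sojourn time of a job is the time from its arrival until all its sub-tasks are finished; in the non-purging $(n,k)$ queue it is the time until $k$ of its sub-tasks are finished, the others being still served; in the purging $(n,k)$ queue it is the time until $k$ of its sub-tasks are finished, and at that instant all remaining sub-tasks of the job are removed from the sub-queues and from service. The stable sojourn time is the limit in distribution, as $j\to\infty$, of the sojourn time of job $j$, and the expected sojourn time is the expectation of this limit. For $m\le n$, a basic $(m,m)$ queue is equivalent to the given queue if its arrival process and service times have the joint law of the arrival process and of the service times at $m$ distinct nodes of the given queue. Define integers, for $k\le i\le n$, by $$A^{n,k}_k=1,\qquad A^{n,k}_i=-\sum_{j=1}^{i-k}\binom{n-i+j}{j}A^{n,k}_{i-j}\quad(k<i\le n),\qquad W_i^{n,k}=\sum_{j=k}^{i}\binom nj A^{n,j}_i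 .$$ Suppose that for every $i\in\{k,\dots,n\}$ the equivalent basic $(i,i)$ fork-join queue has a stable sojourn time, with finite expectation $\mathbb T_i$. Then: 1. The equivalent non-purging $(n,k)$ fork-join queue has a stable sojourn time, and its expectation is finite and equal to $\sum_{i=k}^{n}W_i^{n,k}\,\mathbb T_i$. 2. If the purging $(n,k)$ fork-join queue has a stable sojourn time, then its expectation $\mathbb{PT}_{n,k}$ is finite and $$\mathbb{PT}_{n,k}\le\sum_{i=k}^{n}W_i^{n,k}\,\mathbb T_i .$$ 3. If the sequence of pairs (inter-arrival time from job $j$ to job $j+1$, service-time vector of job $j$), $j\ge 0$, is stationary, then the purging $(n,k)$ fork-join queue does have a stable sojourn time. -/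

import Mathlib

open MeasureTheory ProbabilityTheory Filter Topology

namespace ForkJoin

/-- The `k`-th smallest of the `m` real numbers `x i`, counted with multiplicity
(meaningful for `1 ≤ k ≤ m`). -/
noncomputable def orderStat {m : ℕ} (k : ℕ) (x : Fin m → ℝ) : ℝ :=
  sInf {t : ℝ | k ≤ (Finset.univ.filter fun i => x i ≤ t).card}

/-! ### The constants of the linear transformation -/

/-- The coefficients `A^{n,k}_i`, for `k ≤ i ≤ n`: `A^{n,k}_k = 1` and
`A^{n,k}_i = - ∑_{j=1}^{i-k} (n-i+j choose j) A^{n,k}_{i-j}` for `i > k`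
(the summation index below is `j - 1`). -/
def coeffA (n k : ℕ) (i : ℕ) : ℤ :=
  if i ≤ k then (if i = k then 1 else 0)
  else -∑ j : Fin (i - k), ((n - i + (j + 1)).choose (j + 1) : ℤ) * coeffA n k (i - (j + 1))
termination_by i
decreasing_by omega

/-- The coefficients `W^{n,k}_i = ∑_{j=k}^{i} (n choose j) A^{n,j}_i`, for `k ≤ i ≤ n`. -/
def coeffW (n k i : ℕ) : ℤ :=
  ∑ j ∈ Finset.Icc k i, (n.choose j : ℤ) * coeffA n j i

/-! ### Sample-path dynamics

Jobs are numbered `0, 1, 2, …`; `τ j` is the time between the arrivals of the jobs `j` and `j + 1`,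
and `S j i` is the service time of the sub-task of job `j` at node `i`. Job `0` arrives at time `0`
in an empty system. Every node serves its unbounded sub-queue first-come-first-served. -/

/-- Arrival time of job `j`. -/
def arrival (τ : ℕ → ℝ) (j : ℕ) : ℝ := ∑ l ∈ Finset.range j, τ l

/-- Without purging: the time at which node `i` finishes the sub-task of job `j`. The sub-task is
started when job `j` has arrived and node `i` has finished the previous sub-task. -/
noncomputable def finish {m : ℕ} (τ : ℕ → ℝ) (S : ℕ → Fin m → ℝ) : ℕ → Fin m → ℝ
  | 0 => fun i => arrival τ 0 + S 0 i
  | j + 1 => fun i => max (arrival τ (j + 1)) (finish τ S j i) + S (j + 1) i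

/-- With purging: the time at which node `i` would finish the sub-task of job `j` if this sub-task
were not purged. The `k`-th smallest of these times over the nodes is the time `C` at which job `j`
receives its `k`-th answer, and then all its remaining sub-tasks, waiting or in service, are
removed. Jobs thus receive their `k`-th answers in order of arrival, so no node works on a job
before `j` after time `C`, and node `i` becomes available to job `j + 1` at the minimum of `C` and
its own finishing time for job `j`. -/
noncomputable def purgingFinish {m : ℕ} (k : ℕ) (τ : ℕ → ℝ) (S : ℕ → Fin m → ℝ) :
    ℕ → Fin m → ℝ
  | 0 => fun i => arrival τ 0 + S 0 i
  | j + 1 => fun i =>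
      max (arrival τ (j + 1))
        (min (purgingFinish k τ S j i) (orderStat k (purgingFinish k τ S j))) + S (j + 1) i

/-! ### Stochastic input -/

universe u v

/-- The random input (inter-arrival times and service times) of a fork-join queue with `m` nodes. No
independence is required. -/
structure Input (m : ℕ) where
  /-- the sample space -/
  Ω : Type u
  [mΩ : MeasurableSpace Ω]
  /-- the probability -/
  P : Measure Ω
  [isProb : IsProbabilityMeasure P]
  /-- `interarrival j` is the time between the arrivals of the jobs `j` and `j + 1` -/
  interarrival : ℕ → Ω → ℝ
  /-- `service j i` is the service time of the sub-task of job `j` at node `i` -/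
  service : ℕ → Fin m → Ω → ℝ
  measurable_interarrival : ∀ j, Measurable (interarrival j)
  measurable_service : ∀ j i, Measurable (service j i)
  interarrival_nonneg : ∀ j, ∀ᵐ ω ∂P, 0 ≤ interarrival j ω
  service_nonneg : ∀ j i, ∀ᵐ ω ∂P, 0 ≤ service j i ω

attribute [instance] Input.mΩ Input.isProb

namespace Input

variable {m n : ℕ}

/-- The joint law of the arrival process and of the service times at the nodes `f 0, f 1, …`. -/
noncomputable def law (Q : Input.{u} n) (f : Fin m → Fin n) :
    Measure ((ℕ → ℝ) × (ℕ → Fin m → ℝ)) :=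
  Q.P.map fun ω => (fun j => Q.interarrival j ω, fun j i => Q.service j (f i) ω)

/-- The nodes are interchangeable: permuting them does not change the law of the input. -/
def Homogeneous (Q : Input.{u} n) : Prop :=
  ∀ σ : Equiv.Perm (Fin n), Q.law σ = Q.law id

/-- `R` is the input of an `m`-node queue under the same job arrival process and with the same
service times (in law) as some `m` distinct nodes of `Q`; if `Q` is homogeneous, the choice of these
nodes is immaterial. -/
def Equivalent (R : Input.{v} m) (Q : Input.{u} n) : Prop :=
  ∃ f : Fin m ↪ Fin n, R.law id = Q.law f

/-- The input is stationary: its law does not change if the first job is deleted. -/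
def Stationary (Q : Input.{u} n) : Prop :=
  (Q.P.map fun ω => (fun j => Q.interarrival (j + 1) ω, fun j i => Q.service (j + 1) i ω)) =
    Q.law id

/-- Sojourn time of job `j` in the basic fork-join queue: from its arrival until all its sub-tasks
are finished. -/
noncomputable def basicSojourn (Q : Input.{u} n) (j : ℕ) (ω : Q.Ω) : ℝ :=
  (⨆ i, finish (fun l => Q.interarrival l ω) (fun l i => Q.service l i ω) j i)
    - arrival (fun l => Q.interarrival l ω) j

/-- Sojourn time of job `j` in the non-purging `(n,k)` fork-join queue: from its arrival until `k`
of its sub-tasks are finished. -/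
noncomputable def nonPurgingSojourn (Q : Input.{u} n) (k j : ℕ) (ω : Q.Ω) : ℝ :=
  orderStat k (finish (fun l => Q.interarrival l ω) (fun l i => Q.service l i ω) j)
    - arrival (fun l => Q.interarrival l ω) j

/-- Sojourn time of job `j` in the purging `(n,k)` fork-join queue. -/
noncomputable def purgingSojourn (Q : Input.{u} n) (k j : ℕ) (ω : Q.Ω) : ℝ :=
  orderStat k (purgingFinish k (fun l => Q.interarrival l ω) (fun l i => Q.service l i ω) j)
    - arrival (fun l => Q.interarrival l ω) j

/-- `ν` is the law of the stable sojourn time: the sojourn time `X j` of job `j` converges in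
distribution to `ν` as `j → ∞`. -/
def HasStableLaw (Q : Input.{u} n) (X : ℕ → Q.Ω → ℝ) (ν : ProbabilityMeasure ℝ) : Prop :=
  TendstoInDistribution X atTop (id : ℝ → ℝ) (fun _ => Q.P) (ν : Measure ℝ)

end Input

end ForkJoin

namespace ForkJoin

/-! ### Binomial identities -/

/-! Without purging, the nodes do not influence each other: the finishing times at a set of `i`
nodes are those of a basic queue on these nodes alone (`finish_comp`), and by homogeneity their law
depends only on `i`. The non-purging sojourn time is at most `t` iff at least `k` nodes have
finished within `t`. Inclusion-exclusion expresses this event by the events "all nodes of `I` have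
finished", each having the probability that a basic `(i,i)` sojourn time is at most `t`. Since
`coeffA` has a closed form, the total weight of the `i`-subsets is `coeffW`, so for every job the
distribution function is the `coeffW`-combination of the basic ones
(`measureReal_nonPurgingSojourn_le`).

This identity passes to the weak limit although the weights have both signs:
`exists_tendsto_of_linear_combination` realizes the limit as a difference of two positive measures.
Its mean is computed from the limit laws themselves, so no convergence of means is needed.

Fed with the same input, the purging queue is never later than the non-purging one. Stochastic
domination survives weak limits, which bounds the mean. For stationary input, a Loynes-type argument
makes the purging sojourn times stochastically increasing, and the non-purging queue keeps them
tight, so they converge. -/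

theorem sum_range_neg_one_pow_mul_choose {M L : ℕ} (h : M < L) :
    ∑ l ∈ Finset.range L, (-1 : ℤ) ^ l * (M.choose l : ℤ) = if M = 0 then 1 else 0 := by
  rw [← Int.alternating_sum_range_choose]
  symm
  refine Finset.sum_subset (fun x hx => ?_) (fun x _ hx => ?_)
  · simp only [Finset.mem_range] at hx ⊢; omega
  · simp only [Finset.mem_range, not_lt] at hx
    simp [Nat.choose_eq_zero_of_lt (show M < x by omega)]

/-- This is the recursion of `coeffA` for the closed form, with `p = n - k` and `m = i - k`.
Trinomial revision pulls out `p.choose m` and leaves the expansion of `(1 - 1) ^ m`. -/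
theorem sum_range_neg_one_pow_mul_choose_mul_choose {p m : ℕ} (hm : 0 < m) (hmp : m ≤ p) :
    ∑ j ∈ Finset.range (m + 1),
      ((p - m + j).choose j : ℤ) * ((-1 : ℤ) ^ (m - j) * (p.choose (m - j) : ℤ)) = 0 := by
  have key : ∀ j ∈ Finset.range (m + 1),
      ((p - m + j).choose j : ℤ) * ((-1 : ℤ) ^ (m - j) * (p.choose (m - j) : ℤ)) =
        (p.choose m : ℤ) * ((-1 : ℤ) ^ (m - j) * (m.choose (m - j) : ℤ)) := by
    intro j hj
    have hj : j ≤ m := by simpa [Nat.lt_succ_iff] using hj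
    have h := Nat.choose_mul (n := p) (k := m) (s := m - j) (by omega)
    rw [show p - (m - j) = p - m + j by omega, show m - (m - j) = j by omega] at h
    have h' : (p.choose m : ℤ) * (m.choose (m - j) : ℤ) =
        (p.choose (m - j) : ℤ) * ((p - m + j).choose j : ℤ) := by exact_mod_cast h
    linear_combination (-(-1 : ℤ) ^ (m - j)) * h'
  rw [Finset.sum_congr rfl key, ← Finset.mul_sum]
  have h := Finset.sum_range_reflect (fun l => (-1 : ℤ) ^ l * (m.choose l : ℤ)) (m + 1)
  simp only [Nat.add_sub_cancel] at h
  rw [h, sum_range_neg_one_pow_mul_choose (Nat.lt_succ_self m), if_neg hm.ne', mul_zero]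

/-- Closed form of the coefficients `A^{n,k}_i`. -/
theorem coeffA_eq (n k i : ℕ) (hki : k ≤ i) (hin : i ≤ n) :
    coeffA n k i = (-1) ^ (i - k) * ((n - k).choose (i - k) : ℤ) := by
  induction i using Nat.strong_induction_on with
  | _ i ih =>
    rcases hki.eq_or_lt with rfl | hlt
    · rw [coeffA]; simp
    · rw [coeffA, if_neg (by omega)]
      have h0 := sum_range_neg_one_pow_mul_choose_mul_choose (p := n - k) (m := i - k)
        (by omega) (by omega)
      -- The term `j = 0` is the claimed value at `i`; the others form the sum in the recursion.
      rw [Finset.sum_range_succ', ← Fin.sum_univ_eq_sum_range (fun j =>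
        ((n - k - (i - k) + (j + 1)).choose (j + 1) : ℤ) *
          ((-1 : ℤ) ^ (i - k - (j + 1)) * ((n - k).choose (i - k - (j + 1)) : ℤ)))] at h0
      have h1 : ∀ j : Fin (i - k),
          ((n - i + (j + 1)).choose (j + 1) : ℤ) * coeffA n k (i - (j + 1)) =
          ((n - k - (i - k) + (j + 1)).choose (j + 1) : ℤ) *
          ((-1 : ℤ) ^ (i - k - (j + 1)) * ((n - k).choose (i - k - (j + 1)) : ℤ)) := by
        intro j
        have hj := j.2
        rw [ih _ (by omega) (by omega) (by omega),
          show i - (↑j + 1) - k = i - k - (j + 1) by omega,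
          show n - k - (i - k) = n - i by omega]
      rw [Finset.sum_congr rfl fun j _ => h1 j]
      simp only [Nat.add_zero, Nat.choose_zero_right, Nat.cast_one, one_mul, Nat.sub_zero] at h0
      linarith

/-- The weight of each `i`-subset of the nodes in the inclusion-exclusion formula for the event
that at least `k` nodes have some property. -/
def subsetWeight (k i : ℕ) : ℤ := ∑ j ∈ Finset.Icc k i, (-1) ^ (i - j) * (i.choose j : ℤ)

/-- Trinomial revision again: there are `n.choose i` subsets of size `i`, all with the same weight.
-/
theorem coeffW_eq (n k i : ℕ) (hin : i ≤ n) :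
    coeffW n k i = (n.choose i : ℤ) * subsetWeight k i := by
  rw [coeffW, subsetWeight, Finset.mul_sum]
  refine Finset.sum_congr rfl fun j hj => ?_
  obtain ⟨_, hji⟩ := Finset.mem_Icc.1 hj
  rw [coeffA_eq n j i hji hin]
  have h : (n.choose i : ℤ) * (i.choose j : ℤ) =
      (n.choose j : ℤ) * ((n - j).choose (i - j) : ℤ) := by
    exact_mod_cast Nat.choose_mul (n := n) hji
  linear_combination (-(-1 : ℤ) ^ (i - j)) * h

/-- Binomial inversion: it detects that exactly `j` of the properties hold, when `N` of them do. -/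
theorem sum_Icc_neg_one_pow_mul_choose_mul_choose {n N j : ℕ} (hN : N ≤ n) (hj : j ≤ n) :
    ∑ i ∈ Finset.Icc j n, (-1 : ℤ) ^ (i - j) * (i.choose j : ℤ) * (N.choose i : ℤ) =
      if N = j then 1 else 0 := by
  rw [← Finset.Ico_succ_right_eq_Icc, Finset.sum_Ico_eq_sum_range]
  have h : ∀ l ∈ Finset.range (Order.succ n - j),
      (-1 : ℤ) ^ (j + l - j) * ((j + l).choose j : ℤ) * (N.choose (j + l) : ℤ) =
      (N.choose j : ℤ) * ((-1 : ℤ) ^ l * ((N - j).choose l : ℤ)) := by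
    intro l _
    have h := Nat.choose_mul (n := N) (k := j + l) (s := j) (by omega)
    rw [Nat.add_sub_cancel_left] at h
    have h' : (N.choose (j + l) : ℤ) * ((j + l).choose j : ℤ) =
      (N.choose j : ℤ) * ((N - j).choose l : ℤ) := by exact_mod_cast h
    rw [Nat.add_sub_cancel_left]
    linear_combination ((-1 : ℤ) ^ l) * h'
  rw [Finset.sum_congr rfl h, ← Finset.mul_sum,
    sum_range_neg_one_pow_mul_choose (by simp only [Nat.succ_eq_succ]; omega)]
  -- For `N < j` the truncated `N - j` is `0` and the alternating sum is `1`, but the factor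
  -- `N.choose j` vanishes.
  rcases lt_trichotomy N j with hlt | rfl | hlt
  · simp [Nat.choose_eq_zero_of_lt hlt, hlt.ne]
  · simp
  · rw [if_neg (by omega), if_neg (by omega), mul_zero]

theorem sum_subsetWeight_mul_choose {n k N : ℕ} (hN : N ≤ n) :
    ∑ i ∈ Finset.Icc k n, subsetWeight k i * (N.choose i : ℤ) = if k ≤ N then 1 else 0 := by
  simp only [subsetWeight, Finset.sum_mul]
  rw [Finset.sum_comm' (t' := Finset.Icc k n) (s' := fun j => Finset.Icc j n)
    (by intro i j; simp only [Finset.mem_Icc]; omega)]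
  rw [Finset.sum_congr rfl fun j hj =>
    sum_Icc_neg_one_pow_mul_choose_mul_choose hN (Finset.mem_Icc.1 hj).2]
  rw [Finset.sum_ite_eq]
  simp [hN]

/-- Inclusion-exclusion: the event that at least `k` of `n` properties hold, in terms of the events
that all properties in a given set hold. -/
theorem ite_le_card_filter_eq {n k : ℕ} (p : Fin n → Prop) [DecidablePred p] :
    (if k ≤ (Finset.univ.filter p).card then 1 else 0 : ℝ) =
      ∑ i ∈ Finset.Icc k n, ∑ I ∈ Finset.powersetCard i (Finset.univ : Finset (Fin n)),
        (subsetWeight k i : ℝ) * (if ∀ l ∈ I, p l then 1 else 0) := by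
  have hN : (Finset.univ.filter p).card ≤ n := (Finset.card_le_univ _).trans (by simp)
  have h := congrArg (Int.cast : ℤ → ℝ) (sum_subsetWeight_mul_choose (k := k) hN)
  push_cast at h
  rw [← h]
  refine Finset.sum_congr rfl fun i _ => ?_
  rw [← Finset.mul_sum, Finset.sum_boole, ← Finset.card_powersetCard i (Finset.univ.filter p)]
  -- The sets `I` on which `p` holds throughout are the `i`-subsets of the filter, hence the
  -- binomial coefficient.
  congr 3
  ext I
  simp only [Finset.mem_powersetCard, Finset.mem_filter, Finset.subset_iff, Finset.mem_univ,
    true_and, implies_true]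
  tauto

/-! ### Order statistics -/

/-- The infimum is attained: the defining set is bounded below as `1 ≤ k`, nonempty as `k ≤ m`, and
closed as a finite union of intersections of closed half-lines. It is also upward closed. -/
theorem orderStat_le_iff {m k : ℕ} (hk : 1 ≤ k) (hkm : k ≤ m) (x : Fin m → ℝ) (t : ℝ) :
    orderStat k x ≤ t ↔ k ≤ (Finset.univ.filter fun i => x i ≤ t).card := by
  set T : Set ℝ := {t : ℝ | k ≤ (Finset.univ.filter fun i => x i ≤ t).card} with hT
  have hbdd : BddBelow T := by
    obtain ⟨b, hb⟩ := (Set.finite_range x).bddBelow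
    refine ⟨b, fun s hs => ?_⟩
    obtain ⟨i, hi⟩ := Finset.card_pos.1 (hk.trans hs)
    exact (hb ⟨i, rfl⟩).trans (Finset.mem_filter.1 hi).2
  have hne : T.Nonempty := by
    obtain ⟨b, hb⟩ := (Set.finite_range x).bddAbove
    refine ⟨b, ?_⟩
    have : (Finset.univ.filter fun i => x i ≤ b) = Finset.univ :=
      Finset.filter_true_of_mem fun i _ => hb ⟨i, rfl⟩
    simpa [hT, this] using hkm
  have hclosed : IsClosed T := by
    have : T = ⋃ I ∈ {I : Finset (Fin m) | k ≤ I.card}, ⋂ i ∈ I, Set.Ici (x i) := by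
      ext s
      simp only [hT, Set.mem_ofPred_eq, Set.mem_iUnion, Set.mem_iInter, Set.mem_Ici, exists_prop]
      constructor
      · exact fun h => ⟨_, h, fun i hi => (Finset.mem_filter.1 hi).2⟩
      · rintro ⟨I, hI, h⟩
        exact hI.trans (Finset.card_le_card fun i hi =>
          Finset.mem_filter.2 ⟨Finset.mem_univ _, h i hi⟩)
    rw [this]
    exact (Set.toFinite _).isClosed_biUnion fun I _ => isClosed_biInter fun i _ => isClosed_Ici
  constructor
  · intro h
    have hs : orderStat k x ∈ T := hclosed.csInf_mem hne hbdd
    exact le_trans hs (Finset.card_le_card fun i hi => by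
      simp only [Finset.mem_filter, Finset.mem_univ, true_and] at hi ⊢; exact hi.trans h)
  · exact fun h => csInf_le hbdd h

theorem orderStat_add_le {m k : ℕ} (hk : 1 ≤ k) (hkm : k ≤ m) {x y : Fin m → ℝ} {c : ℝ}
    (h : ∀ i, x i + c ≤ y i) : orderStat k x + c ≤ orderStat k y := by
  rw [← le_sub_iff_add_le, orderStat_le_iff hk hkm]
  refine ((orderStat_le_iff hk hkm y _).1 le_rfl).trans (Finset.card_le_card fun i hi => ?_)
  simp only [Finset.mem_filter, Finset.mem_univ, true_and] at hi ⊢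
  linarith [h i]

theorem orderStat_mono {m k : ℕ} (hk : 1 ≤ k) (hkm : k ≤ m) {x y : Fin m → ℝ}
    (h : ∀ i, x i ≤ y i) : orderStat k x ≤ orderStat k y := by
  simpa using orderStat_add_le hk hkm (c := 0) (by simpa using h)

theorem le_orderStat {m k : ℕ} (hk : 1 ≤ k) (hkm : k ≤ m) {x : Fin m → ℝ} {c : ℝ}
    (h : ∀ i, c ≤ x i) : c ≤ orderStat k x := by
  obtain ⟨i, hi⟩ := Finset.card_pos.1 (hk.trans ((orderStat_le_iff hk hkm x _).1 le_rfl))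
  exact (h i).trans (Finset.mem_filter.1 hi).2

theorem measurable_orderStat {m k : ℕ} (hk : 1 ≤ k) (hkm : k ≤ m) :
    Measurable (orderStat k : (Fin m → ℝ) → ℝ) := by
  refine measurable_of_Iic fun t => ?_
  have : orderStat k ⁻¹' Set.Iic t = {x : Fin m → ℝ | k ≤ ∑ i, if x i ≤ t then 1 else 0} := by
    ext x
    simp only [Set.mem_preimage, Set.mem_Iic, Set.mem_ofPred_eq, orderStat_le_iff hk hkm,
      Finset.card_filter]
  rw [this]
  refine measurableSet_le measurable_const (Finset.measurable_sum _ fun i _ => ?_)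
  exact Measurable.ite (measurableSet_le (measurable_pi_apply i) measurable_const)
    measurable_const measurable_const

/-! ### Weak convergence of measures on the line -/

/-- Thickened indicators give the inequality on closed sets, and inner regularity extends it to
measurable sets. -/
theorem measure_le_of_forall_lintegral_le {X : Type*} [MeasurableSpace X] [PseudoEMetricSpace X]
    [BorelSpace X] {μ ν : Measure X} [IsFiniteMeasure μ] [IsFiniteMeasure ν]
    (h : ∀ f : BoundedContinuousFunction X NNReal, ∫⁻ x, f x ∂μ ≤ ∫⁻ x, f x ∂ν) : μ ≤ ν := by
  have hclosed : ∀ F : Set X, IsClosed F → μ F ≤ ν F := by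
    intro F hF
    have hpos : ∀ n : ℕ, (0 : ℝ) < 1 / ((n : ℝ) + 1) := fun n => by positivity
    have hlim : Tendsto (fun n : ℕ => (1 : ℝ) / ((n : ℝ) + 1)) atTop (𝓝 0) :=
      tendsto_one_div_add_atTop_nhds_zero_nat
    exact le_of_tendsto_of_tendsto'
      (tendsto_lintegral_thickenedIndicator_of_isClosed μ hF hpos hlim)
      (tendsto_lintegral_thickenedIndicator_of_isClosed ν hF hpos hlim) fun n => h _
  refine Measure.le_intro fun s hs _ => ?_
  rw [hs.measure_eq_iSup_isClosed_of_ne_top (measure_ne_top μ s)]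
  refine iSup₂_le fun K hK => iSup_le fun hKc => (hclosed K hKc).trans (measure_mono hK)

/-! ### Natural-number combinations of measures: the positive and negative parts of a signed one -/

section SignedCombination

variable {ι : Type*} (s : Finset ι) (c : ι → ℕ) (β : ι → Measure ℝ)

theorem integrable_sum_nsmul {f : ℝ → ℝ} (hf : ∀ i ∈ s, Integrable f (β i)) :
    Integrable f (∑ i ∈ s, c i • β i) :=
  integrable_finsetSum_measure.2 fun i hi => by
    rw [← Nat.cast_smul_eq_nsmul ENNReal]
    exact (hf i hi).smul_measure (by simp)

theorem integral_sum_nsmul {f : ℝ → ℝ} (hf : ∀ i ∈ s, Integrable f (β i)) :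
    ∫ x, f x ∂(∑ i ∈ s, c i • β i) = ∑ i ∈ s, (c i : ℝ) * ∫ x, f x ∂(β i) := by
  rw [integral_finsetSum_measure fun i hi => by
    rw [← Nat.cast_smul_eq_nsmul ENNReal]
    exact (hf i hi).smul_measure (by simp)]
  refine Finset.sum_congr rfl fun i _ => ?_
  rw [← Nat.cast_smul_eq_nsmul ENNReal, integral_smul_measure]
  simp

theorem measureReal_sum_nsmul [∀ i, IsFiniteMeasure (β i)] {t : Set ℝ} (ht : MeasurableSet t) :
    (∑ i ∈ s, c i • β i).real t = ∑ i ∈ s, (c i : ℝ) * (β i).real t := by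
  have := integral_sum_nsmul s c β (f := t.indicator 1)
    fun i _ => (integrable_const (1 : ℝ)).indicator ht
  simpa [integral_indicator_one ht] using this

instance isFiniteMeasure_sum_nsmul [∀ i, IsFiniteMeasure (β i)] :
    IsFiniteMeasure (∑ i ∈ s, c i • β i) := by
  refine ⟨?_⟩
  simp only [Measure.coe_finsetSum, Finset.sum_apply, Measure.smul_apply, ENNReal.sum_lt_top]
  intro i _
  rw [nsmul_eq_mul]
  exact ENNReal.mul_lt_top (by simp) (measure_lt_top _ _)

end SignedCombination

theorem cast_eq_toNat_sub_toNat (w : ℤ) : (w : ℝ) = (w.toNat : ℝ) - ((-w).toNat : ℝ) := by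
  exact_mod_cast (Int.toNat_sub_toNat_neg w).symm

/-- If the distribution functions of probability laws `μ j` are fixed linear combinations of those
of laws `βj i j`, and each `βj i j` converges weakly to `β i` as `j → ∞`, then `μ j` converges
weakly, and integrals of the limit are given by the same linear combination. -/
theorem exists_tendsto_of_linear_combination {ι : Type*} (s : Finset ι) (w : ι → ℤ)
    (μ : ℕ → ProbabilityMeasure ℝ) (βj : ι → ℕ → ProbabilityMeasure ℝ)
    (β : ι → ProbabilityMeasure ℝ) (hβ : ∀ i ∈ s, Tendsto (βj i) atTop (𝓝 (β i)))
    (h : ∀ j t, (μ j : Measure ℝ).real (Set.Iic t) =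
      ∑ i ∈ s, (w i : ℝ) * (βj i j : Measure ℝ).real (Set.Iic t)) :
    ∃ ν : ProbabilityMeasure ℝ, Tendsto μ atTop (𝓝 ν) ∧
      ∀ f : ℝ → ℝ, (∀ i ∈ s, Integrable f (β i : Measure ℝ)) → Integrable f (ν : Measure ℝ) ∧
        ∫ x, f x ∂(ν : Measure ℝ) = ∑ i ∈ s, (w i : ℝ) * ∫ x, f x ∂(β i : Measure ℝ) := by
  have hsum : ∀ a : ι → ℝ, ∑ i ∈ s, (w i : ℝ) * a i =
      ∑ i ∈ s, ((w i).toNat : ℝ) * a i - ∑ i ∈ s, ((-w i).toNat : ℝ) * a i := by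
    intro a
    rw [← Finset.sum_sub_distrib]
    exact Finset.sum_congr rfl fun i _ => by rw [cast_eq_toNat_sub_toNat]; ring
  -- With the negative weights moved to the left, both sides are finite measures agreeing on
  -- half-lines, hence equal.
  have hadd : ∀ j, (μ j : Measure ℝ) + ∑ i ∈ s, (-w i).toNat • (βj i j : Measure ℝ) =
      ∑ i ∈ s, (w i).toNat • (βj i j : Measure ℝ) := by
    intro j
    refine Measure.ext_of_Iic _ _ fun t => ?_
    rw [← measureReal_eq_measureReal_iff, measureReal_add_apply,
      measureReal_sum_nsmul _ _ _ measurableSet_Iic,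
      measureReal_sum_nsmul _ _ _ measurableSet_Iic, h, hsum]
    ring
  have hint : ∀ j (f : BoundedContinuousFunction ℝ ℝ), ∫ x, f x ∂(μ j : Measure ℝ) =
      ∑ i ∈ s, (w i : ℝ) * ∫ x, f x ∂(βj i j : Measure ℝ) := by
    intro j f
    have h1 : ∫ x, f x ∂((μ j : Measure ℝ) + ∑ i ∈ s, (-w i).toNat • (βj i j : Measure ℝ)) =
        ∫ x, f x ∂(∑ i ∈ s, (w i).toNat • (βj i j : Measure ℝ)) := by rw [hadd j]
    rw [integral_add_measure (f.integrable _) (f.integrable _),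
      integral_sum_nsmul _ _ _ (fun i _ => f.integrable _),
      integral_sum_nsmul _ _ _ (fun i _ => f.integrable _)] at h1
    rw [hsum]
    linarith
  have hlim : ∀ f : BoundedContinuousFunction ℝ ℝ,
      Tendsto (fun j => ∫ x, f x ∂(μ j : Measure ℝ)) atTop
        (𝓝 (∑ i ∈ s, (w i : ℝ) * ∫ x, f x ∂(β i : Measure ℝ))) := by
    intro f
    simp only [hint]
    exact tendsto_finsetSum _ fun i hi =>
      (ProbabilityMeasure.tendsto_iff_forall_integral_tendsto.1 (hβ i hi) f).const_mul _
  set Pl : Measure ℝ := ∑ i ∈ s, (w i).toNat • (β i : Measure ℝ) with hPl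
  set Mi : Measure ℝ := ∑ i ∈ s, (-w i).toNat • (β i : Measure ℝ) with hMi
  -- The limit functional is positive, being a limit of integrals against the `μ j`; so the
  -- difference `Pl - Mi` is a genuine measure.
  have hle : Mi ≤ Pl := by
    refine measure_le_of_forall_lintegral_le fun f => ?_
    let g : BoundedContinuousFunction ℝ ℝ :=
      ⟨⟨fun x => (f x : ℝ), NNReal.continuous_coe.comp f.continuous⟩, f.map_bounded'⟩
    have hg : 0 ≤ ∑ i ∈ s, (w i : ℝ) * ∫ x, g x ∂(β i : Measure ℝ) :=
      ge_of_tendsto' (hlim g) fun j => integral_nonneg fun x => (f x).2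
    rw [hsum, ← integral_sum_nsmul _ _ _ (fun i _ => g.integrable _),
      ← integral_sum_nsmul _ _ _ (fun i _ => g.integrable _)] at hg
    rw [← ENNReal.toReal_le_toReal (BoundedContinuousFunction.lintegral_lt_top_of_nnreal _ f).ne
      (BoundedContinuousFunction.lintegral_lt_top_of_nnreal _ f).ne,
      BoundedContinuousFunction.toReal_lintegral_coe_eq_integral,
      BoundedContinuousFunction.toReal_lintegral_coe_eq_integral]
    exact sub_nonneg.1 hg
  have hsub : Pl - Mi + Mi = Pl := Measure.sub_add_cancel_of_le hle
  have hν : ∀ f : ℝ → ℝ, (∀ i ∈ s, Integrable f (β i : Measure ℝ)) → Integrable f (Pl - Mi) ∧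
      ∫ x, f x ∂(Pl - Mi) = ∑ i ∈ s, (w i : ℝ) * ∫ x, f x ∂(β i : Measure ℝ) := by
    intro f hf
    have hP : Integrable f Pl := integrable_sum_nsmul _ _ _ hf
    have hD : Integrable f (Pl - Mi) := hP.mono_measure Measure.sub_le
    refine ⟨hD, ?_⟩
    have h1 : ∫ x, f x ∂(Pl - Mi + Mi) = ∫ x, f x ∂Pl := by rw [hsub]
    rw [integral_add_measure hD (integrable_sum_nsmul _ _ _ hf), hPl, hMi,
      integral_sum_nsmul _ _ _ hf, integral_sum_nsmul _ _ _ hf] at h1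
    rw [hsum]
    linarith
  -- No mass is lost: testing the limit with the constant `1` shows that the weights sum to `1`.
  have hprob : IsProbabilityMeasure (Pl - Mi) := by
    have h1 := (hν (fun _ => 1) fun i _ => integrable_const _).2
    have h2 := tendsto_nhds_unique (hlim (BoundedContinuousFunction.const ℝ 1)) (by simp; rfl)
    simp only [BoundedContinuousFunction.const_apply] at h2
    rw [h2] at h1
    have : IsFiniteMeasure (Pl - Mi) := isFiniteMeasure_of_le Pl Measure.sub_le
    simp only [integral_const, smul_eq_mul, mul_one] at h1
    exact ⟨by rwa [measureReal_def, ENNReal.toReal_eq_one_iff] at h1⟩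
  let ν : ProbabilityMeasure ℝ := ⟨Pl - Mi, hprob⟩
  refine ⟨ν, ?_, hν⟩
  rw [ProbabilityMeasure.tendsto_iff_forall_integral_tendsto]
  intro f
  have := hlim f
  rw [← (hν f fun i _ => f.integrable _).2] at this
  exact this

/-- Weak limits preserve stochastic domination, up to the boundary of the tails. -/
theorem measure_Ioi_le_measure_Ici_of_tendsto {π μ : ℕ → ProbabilityMeasure ℝ}
    {π₀ μ₀ : ProbabilityMeasure ℝ} (hπ : Tendsto π atTop (𝓝 π₀)) (hμ : Tendsto μ atTop (𝓝 μ₀))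
    (h : ∀ j t, (π j : Measure ℝ) (Set.Ioi t) ≤ (μ j : Measure ℝ) (Set.Ioi t)) (t : ℝ) :
    (π₀ : Measure ℝ) (Set.Ioi t) ≤ (μ₀ : Measure ℝ) (Set.Ici t) :=
  calc (π₀ : Measure ℝ) (Set.Ioi t)
      ≤ atTop.liminf fun j => (π j : Measure ℝ) (Set.Ioi t) :=
        ProbabilityMeasure.le_liminf_measure_open_of_tendsto hπ isOpen_Ioi
    _ ≤ atTop.liminf fun j => (μ j : Measure ℝ) (Set.Ici t) :=
        liminf_le_liminf (Eventually.of_forall fun j =>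
          (h j t).trans (measure_mono Set.Ioi_subset_Ici_self))
    _ ≤ atTop.limsup fun j => (μ j : Measure ℝ) (Set.Ici t) := liminf_le_limsup
    _ ≤ (μ₀ : Measure ℝ) (Set.Ici t) :=
        ProbabilityMeasure.limsup_measure_closed_le_of_tendsto hμ isClosed_Ici

theorem ae_nonneg_of_tendsto {π : ℕ → ProbabilityMeasure ℝ} {π₀ : ProbabilityMeasure ℝ}
    (hπ : Tendsto π atTop (𝓝 π₀)) (h : ∀ j, ∀ᵐ x ∂(π j : Measure ℝ), 0 ≤ x) :
    ∀ᵐ x ∂(π₀ : Measure ℝ), 0 ≤ x := by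
  have h1 := ProbabilityMeasure.le_liminf_measure_open_of_tendsto hπ (isOpen_Iio (a := (0 : ℝ)))
  have h2 : ∀ j, (π j : Measure ℝ) (Set.Iio 0) = 0 := by
    intro j
    have := h j
    rw [ae_iff] at this
    simpa [Set.Iio] using this
  simp only [h2, liminf_const, nonpos_iff_eq_zero] at h1
  rw [ae_iff]
  simpa [Set.Iio] using h1

/-- Comparison of the means of the weak limits of stochastically ordered nonnegative laws. -/
theorem integrable_and_integral_le_of_tendsto {π μ : ℕ → ProbabilityMeasure ℝ}
    {π₀ μ₀ : ProbabilityMeasure ℝ} (hπ : Tendsto π atTop (𝓝 π₀)) (hμ : Tendsto μ atTop (𝓝 μ₀))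
    (h : ∀ j t, (π j : Measure ℝ) (Set.Ioi t) ≤ (μ j : Measure ℝ) (Set.Ioi t))
    (hπ0 : ∀ j, ∀ᵐ x ∂(π j : Measure ℝ), 0 ≤ x) (hμ0 : ∀ j, ∀ᵐ x ∂(μ j : Measure ℝ), 0 ≤ x)
    (hint : Integrable (fun x : ℝ => x) (μ₀ : Measure ℝ)) :
    Integrable (fun x : ℝ => x) (π₀ : Measure ℝ) ∧
      ∫ x, x ∂(π₀ : Measure ℝ) ≤ ∫ x, x ∂(μ₀ : Measure ℝ) := by
  have hp := ae_nonneg_of_tendsto hπ hπ0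
  have hm := ae_nonneg_of_tendsto hμ hμ0
  have hle : ∫⁻ x, ENNReal.ofReal x ∂(π₀ : Measure ℝ) ≤
      ∫⁻ x, ENNReal.ofReal x ∂(μ₀ : Measure ℝ) := by
    -- Open tails on one side and closed tails on the other match the portmanteau comparison, so
    -- atoms need no care.
    rw [lintegral_eq_lintegral_meas_lt (π₀ : Measure ℝ) hp aemeasurable_id,
      lintegral_eq_lintegral_meas_le (μ₀ : Measure ℝ) hm aemeasurable_id]
    exact lintegral_mono fun t => measure_Ioi_le_measure_Ici_of_tendsto hπ hμ h t
  have hfin : ∫⁻ x, ENNReal.ofReal x ∂(μ₀ : Measure ℝ) < ⊤ := by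
    rw [← ofReal_integral_eq_lintegral_ofReal hint hm]; simp
  have hi : Integrable (fun x : ℝ => x) (π₀ : Measure ℝ) :=
    (lintegral_ofReal_ne_top_iff_integrable measurable_id.aestronglyMeasurable hp).1
      (hle.trans_lt hfin).ne
  refine ⟨hi, ?_⟩
  rw [integral_eq_lintegral_of_nonneg_ae hp measurable_id.aestronglyMeasurable,
    integral_eq_lintegral_of_nonneg_ae hm measurable_id.aestronglyMeasurable]
  exact ENNReal.toReal_mono hfin.ne hle

/-- Pointwise convergence of distribution functions implies weak convergence. -/
theorem tendsto_of_tendsto_measureReal_Iic {π : ℕ → ProbabilityMeasure ℝ}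
    {π₀ : ProbabilityMeasure ℝ}
    (h : ∀ t, Tendsto (fun j => (π j : Measure ℝ).real (Set.Iic t)) atTop
      (𝓝 ((π₀ : Measure ℝ).real (Set.Iic t)))) : Tendsto π atTop (𝓝 π₀) := by
  refine IsPiSystem.tendsto_probabilityMeasure_of_tendsto_of_mem
    (S := {S | ∃ l u : ℝ, l < u ∧ Set.Ioc l u = S}) (isPiSystem_Ioc id id) ?_ ?_ ?_
  · rintro _ ⟨a, b, _, rfl⟩
    exact measurableSet_Ioc
  · intro u hu x hx
    obtain ⟨ε, hε, hball⟩ := Metric.isOpen_iff.1 hu x hx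
    refine ⟨_, ⟨x - ε / 2, x + ε / 2, by linarith, rfl⟩, ?_, ?_⟩
    · exact Ioc_mem_nhds (by linarith) (by linarith)
    · intro y hy
      refine hball ?_
      rw [Metric.mem_ball, Real.dist_eq, abs_lt]
      constructor <;> linarith [hy.1, hy.2]
  · rintro _ ⟨a, b, hab, rfl⟩
    rw [← NNReal.tendsto_coe]
    have hIoc : ∀ m : ProbabilityMeasure ℝ, ((m (Set.Ioc a b) : NNReal) : ℝ) =
        (m : Measure ℝ).real (Set.Iic b) - (m : Measure ℝ).real (Set.Iic a) := by
      intro m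
      rw [← measureReal_sdiff (Set.Iic_subset_Iic.2 hab.le) measurableSet_Iic, Set.Iic_sdiff_Iic]
      rfl
    simp only [hIoc]
    exact (h b).sub (h a)

/-- A stochastically increasing sequence of laws that is stochastically dominated by a weakly
convergent sequence is weakly convergent. -/
theorem exists_tendsto_of_antitone_cdf {π μ : ℕ → ProbabilityMeasure ℝ}
    {μ₀ : ProbabilityMeasure ℝ} (hμ : Tendsto μ atTop (𝓝 μ₀))
    (hπ : ∀ t, Antitone fun j => (π j : Measure ℝ).real (Set.Iic t))
    (h : ∀ j t, (μ j : Measure ℝ) (Set.Iic t) ≤ (π j : Measure ℝ) (Set.Iic t)) :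
    ∃ π₀ : ProbabilityMeasure ℝ, Tendsto π atTop (𝓝 π₀) := by
  set F : ℕ → ℝ → ℝ := fun j t => (π j : Measure ℝ).real (Set.Iic t) with hF
  have hbdd : ∀ t, BddBelow (Set.range fun j => F j t) :=
    fun t => ⟨0, by rintro _ ⟨j, rfl⟩; exact measureReal_nonneg⟩
  have hmonoF : ∀ j, Monotone (F j) := fun j s t hst =>
    measureReal_mono (Set.Iic_subset_Iic.2 hst)
  have hlim : ∀ t, Tendsto (fun j => F j t) atTop (𝓝 (⨅ j, F j t)) :=
    fun t => tendsto_atTop_ciInf (hπ t) (hbdd t)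
  have hmono : Monotone fun t => ⨅ j, F j t :=
    fun s t hst => ciInf_mono (hbdd s) fun j => hmonoF j hst
  let G : StieltjesFunction ℝ :=
    { toFun := fun t => ⨅ j, F j t
      mono' := hmono
      right_continuous' := by
        intro x
        refine tendsto_order.2 ⟨fun a ha => ?_, fun a ha => ?_⟩
        · filter_upwards [self_mem_nhdsWithin] with y hy
          exact ha.trans_le (hmono hy)
        -- An infimum of right-continuous monotone functions is right-continuous: one nearly optimal
        -- `j` controls it near `x`.
        · obtain ⟨j, hj⟩ := exists_lt_of_ciInf_lt ha
          have hc : ContinuousWithinAt (F j) (Set.Ici x) x := by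
            have := (cdf (π j : Measure ℝ)).right_continuous x
            have e : (cdf (π j : Measure ℝ) : ℝ → ℝ) = F j := funext fun t => cdf_eq_real _ t
            rwa [e] at this
          filter_upwards [hc.eventually (gt_mem_nhds hj)] with y hy
          exact (ciInf_le (hbdd y) j).trans_lt hy }
  have hG : ∀ t, G t = ⨅ j, F j t := fun t => rfl
  have hbot : Tendsto G atBot (𝓝 0) := by
    refine tendsto_of_tendsto_of_tendsto_of_le_of_le tendsto_const_nhds
      (tendsto_cdf_atBot (π 0 : Measure ℝ)) (fun t => ?_) (fun t => ?_)
    · exact le_ciInf fun j => measureReal_nonneg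
    · rw [cdf_eq_real]; exact ciInf_le (hbdd t) 0
  have htop : Tendsto G atTop (𝓝 1) := by
    -- Domination prevents mass from escaping to `+∞`. The shift by `1` makes room for the open
    -- half-line that the portmanteau bound needs.
    have h1 : Tendsto (fun t : ℝ => cdf (μ₀ : Measure ℝ) (t - 1)) atTop (𝓝 1) :=
      (tendsto_cdf_atTop _).comp (tendsto_atTop_add_const_right _ (-1) tendsto_id)
    refine tendsto_of_tendsto_of_tendsto_of_le_of_le h1 tendsto_const_nhds (fun t => ?_)
      (fun t => ?_)
    · have hopen := ProbabilityMeasure.le_liminf_measure_open_of_tendsto hμ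
        (isOpen_Iio (a := t))
      have hlimE : Tendsto (fun j => (π j : Measure ℝ) (Set.Iic t)) atTop
          (𝓝 (ENNReal.ofReal (G t))) := by
        have := (ENNReal.continuous_ofReal.tendsto _).comp (hlim t)
        refine this.congr fun j => ?_
        simp [hF]
      have h2 : (μ₀ : Measure ℝ) (Set.Iic (t - 1)) ≤ ENNReal.ofReal (G t) :=
        calc (μ₀ : Measure ℝ) (Set.Iic (t - 1)) ≤ (μ₀ : Measure ℝ) (Set.Iio t) :=
              measure_mono (Set.Iic_subset_Iio.2 (by linarith))
          _ ≤ atTop.liminf fun j => (μ j : Measure ℝ) (Set.Iio t) := hopen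
          _ ≤ atTop.liminf fun j => (π j : Measure ℝ) (Set.Iic t) :=
              liminf_le_liminf (Eventually.of_forall fun j =>
                (measure_mono Set.Iio_subset_Iic_self).trans (h j t))
          _ = ENNReal.ofReal (G t) := hlimE.liminf_eq
      rw [← ofReal_cdf] at h2
      exact (ENNReal.ofReal_le_ofReal_iff (le_ciInf fun j => measureReal_nonneg)).1 h2
    · exact (ciInf_le (hbdd t) 0).trans measureReal_le_one
  have hprob : IsProbabilityMeasure G.measure := G.isProbabilityMeasure hbot htop
  refine ⟨⟨G.measure, hprob⟩, tendsto_of_tendsto_measureReal_Iic fun t => ?_⟩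
  have : G.measure.real (Set.Iic t) = G t := by
    rw [measureReal_def, G.measure_Iic hbot, sub_zero,
      ENNReal.toReal_ofReal (le_ciInf fun j => measureReal_nonneg)]
  simp only [ProbabilityMeasure.coe_mk, this]
  exact hlim t

/-! ### Sample-path properties -/

section SamplePath

variable {m n : ℕ}

theorem finish_comp (τ : ℕ → ℝ) (S : ℕ → Fin n → ℝ) (f : Fin m → Fin n) (j : ℕ) (l : Fin m) :
    finish τ (fun j i => S j (f i)) j l = finish τ S j (f l) := by
  induction j with
  | zero => rfl
  | succ j ih => simp only [finish, ih]

theorem purgingFinish_le_finish (k : ℕ) (τ : ℕ → ℝ) (S : ℕ → Fin n → ℝ) (j : ℕ) (i : Fin n) :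
    purgingFinish k τ S j i ≤ finish τ S j i := by
  induction j with
  | zero => exact le_rfl
  | succ j ih =>
    simp only [finish, purgingFinish]
    gcongr
    exact (min_le_left _ _).trans ih

theorem arrival_le_purgingFinish (k : ℕ) (τ : ℕ → ℝ) (S : ℕ → Fin n → ℝ)
    (hS : ∀ j i, 0 ≤ S j i) (j : ℕ) (i : Fin n) : arrival τ j ≤ purgingFinish k τ S j i := by
  cases j with
  | zero => exact le_add_of_nonneg_right (hS 0 i)
  | succ j => exact (le_max_left _ _).trans (le_add_of_nonneg_right (hS _ i))

theorem arrival_succ_eq (τ : ℕ → ℝ) (j : ℕ) :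
    arrival τ (j + 1) = arrival (fun l => τ (l + 1)) j + τ 0 :=
  Finset.sum_range_succ' _ _

/-- Monotonicity in the initial state: deleting the first job of the purging queue does not delay
the later jobs. -/
theorem purgingFinish_shift_le {k : ℕ} (hk : 1 ≤ k) (hkn : k ≤ n) (τ : ℕ → ℝ)
    (S : ℕ → Fin n → ℝ) (j : ℕ) (i : Fin n) :
    purgingFinish k (fun l => τ (l + 1)) (fun l => S (l + 1)) j i + τ 0 ≤
      purgingFinish k τ S (j + 1) i := by
  induction j generalizing i with
  | zero =>
    have h := arrival_succ_eq τ 0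
    have h' := le_max_left (arrival τ (0 + 1))
      (min (purgingFinish k τ S 0 i) (orderStat k (purgingFinish k τ S 0)))
    simp only [purgingFinish] at h' ⊢
    linarith
  | succ j ih =>
    rw [purgingFinish, purgingFinish.eq_2 k τ S (j + 1), add_right_comm]
    refine add_le_add ?_ le_rfl
    rw [← max_add_add_right, ← min_add_add_right]
    refine max_le_max (arrival_succ_eq τ (j + 1)).ge (min_le_min (ih i) ?_)
    exact orderStat_add_le hk hkn ih

theorem measurable_arrival (j : ℕ) :
    Measurable fun p : (ℕ → ℝ) × (ℕ → Fin m → ℝ) => arrival p.1 j :=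
  Finset.measurable_sum _ fun l _ => (measurable_pi_apply l).comp measurable_fst

theorem measurable_service_eval (j : ℕ) (i : Fin m) :
    Measurable fun p : (ℕ → ℝ) × (ℕ → Fin m → ℝ) => p.2 j i :=
  (measurable_pi_apply i).comp ((measurable_pi_apply j).comp measurable_snd)

theorem measurable_finish (j : ℕ) :
    Measurable fun p : (ℕ → ℝ) × (ℕ → Fin m → ℝ) => finish p.1 p.2 j := by
  induction j with
  | zero =>
    exact measurable_pi_lambda _ fun i => (measurable_arrival 0).add (measurable_service_eval 0 i)
  | succ j ih =>
    exact measurable_pi_lambda _ fun i => ((measurable_arrival (j + 1)).max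
      ((measurable_pi_apply i).comp ih)).add (measurable_service_eval (j + 1) i)

theorem measurable_purgingFinish {k : ℕ} (hk : 1 ≤ k) (hkm : k ≤ m) (j : ℕ) :
    Measurable fun p : (ℕ → ℝ) × (ℕ → Fin m → ℝ) => purgingFinish k p.1 p.2 j := by
  induction j with
  | zero =>
    exact measurable_pi_lambda _ fun i => (measurable_arrival 0).add (measurable_service_eval 0 i)
  | succ j ih =>
    exact measurable_pi_lambda _ fun i => ((measurable_arrival (j + 1)).max
      (((measurable_pi_apply i).comp ih).min ((measurable_orderStat hk hkm).comp ih))).add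
      (measurable_service_eval (j + 1) i)

/-- The sojourn time of job `j` in the purging queue as a function of the sample path. -/
noncomputable def purgingSojournPath (k j : ℕ) (p : (ℕ → ℝ) × (ℕ → Fin n → ℝ)) : ℝ :=
  orderStat k (purgingFinish k p.1 p.2 j) - arrival p.1 j

theorem measurable_purgingSojournPath {k : ℕ} (hk : 1 ≤ k) (hkn : k ≤ n) (j : ℕ) :
    Measurable (purgingSojournPath (n := n) k j) :=
  ((measurable_orderStat hk hkn).comp (measurable_purgingFinish hk hkn j)).sub
    (measurable_arrival j)

theorem purgingSojournPath_shift_le {k : ℕ} (hk : 1 ≤ k) (hkn : k ≤ n) (j : ℕ)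
    (p : (ℕ → ℝ) × (ℕ → Fin n → ℝ)) :
    purgingSojournPath k j (fun l => p.1 (l + 1), fun l i => p.2 (l + 1) i) ≤
      purgingSojournPath k (j + 1) p := by
  have h := orderStat_add_le hk hkn (purgingFinish_shift_le hk hkn p.1 p.2 j)
  have h' := arrival_succ_eq p.1 j
  simp only [purgingSojournPath]
  linarith

end SamplePath

namespace Input

universe u v

variable {m n : ℕ}

theorem measurable_restrict (Q : Input.{u} n) (f : Fin m → Fin n) :
    Measurable fun ω => ((fun j => Q.interarrival j ω, fun j i => Q.service j (f i) ω) :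
      (ℕ → ℝ) × (ℕ → Fin m → ℝ)) :=
  (measurable_pi_lambda _ Q.measurable_interarrival).prodMk
    (measurable_pi_lambda _ fun j => measurable_pi_lambda _ fun i => Q.measurable_service j (f i))

/-! ### Homogeneity -/

/-- Permutations act transitively on embeddings of `Fin m`, so some `σ` carries `f` to `g`. -/
theorem Homogeneous.law_eq {Q : Input.{u} n} (hQ : Q.Homogeneous) (f g : Fin m ↪ Fin n) :
    Q.law f = Q.law g := by
  have hr : Measurable fun p : (ℕ → ℝ) × (ℕ → Fin n → ℝ) =>
      ((p.1, fun j i => p.2 j (f i)) : (ℕ → ℝ) × (ℕ → Fin m → ℝ)) :=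
    measurable_fst.prodMk (measurable_pi_lambda _ fun j => measurable_pi_lambda _ fun i =>
      measurable_service_eval j (f i))
  have hmap : ∀ σ : Fin n → Fin n, (Q.law σ).map (fun p => (p.1, fun j i => p.2 j (f i))) =
      Q.law (σ ∘ f) := fun σ => Measure.map_map hr (Q.measurable_restrict σ)
  obtain ⟨σ, hσ⟩ := (Equiv.Perm.isMultiplyPretransitive (Fin n) m).exists_smul_eq f g
  have hσf : (σ : Fin n → Fin n) ∘ f = g := by rw [← hσ]; rfl
  rw [← hσf, ← hmap σ, hQ σ, hmap id]
  rfl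

theorem basicSojourn_le_iff {R : Input.{v} m} (hm : 1 ≤ m) (j : ℕ) (ω : R.Ω) (t : ℝ) :
    R.basicSojourn j ω ≤ t ↔ ∀ l, finish (fun l => R.interarrival l ω)
      (fun l i => R.service l i ω) j l - arrival (fun l => R.interarrival l ω) j ≤ t := by
  have : Nonempty (Fin m) := ⟨⟨0, hm⟩⟩
  rw [basicSojourn, sub_le_iff_le_add, ciSup_le_iff (Set.finite_range _).bddAbove]
  simp only [sub_le_iff_le_add]

/-- By homogeneity the nodes in `Equivalent` may be replaced by an enumeration of `I`; a node's
finishing times involve only the arrivals and its own service times. -/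
theorem measureReal_basicSojourn_le {Q : Input.{u} n} (hQ : Q.Homogeneous) {R : Input.{v} m}
    (hR : R.Equivalent Q) (hm : 1 ≤ m) (j : ℕ) (t : ℝ) (I : Finset (Fin n)) (hI : I.card = m) :
    R.P.real {ω | R.basicSojourn j ω ≤ t} =
      Q.P.real {ω | ∀ l ∈ I, finish (fun l => Q.interarrival l ω)
        (fun l i => Q.service l i ω) j l - arrival (fun l => Q.interarrival l ω) j ≤ t} := by
  obtain ⟨f, hf⟩ := hR
  set A : Set ((ℕ → ℝ) × (ℕ → Fin m → ℝ)) :=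
    {p | ∀ l, finish p.1 p.2 j l - arrival p.1 j ≤ t} with hA
  have hAm : MeasurableSet A := by
    have : A = ⋂ l, {p | finish p.1 p.2 j l - arrival p.1 j ≤ t} := by
      ext p; simp [hA]
    rw [this]
    exact MeasurableSet.iInter fun l => measurableSet_le
      (((measurable_pi_apply l).comp (measurable_finish j)).sub (measurable_arrival j))
      measurable_const
  let g : Fin m ↪ Fin n := (I.orderEmbOfFin hI).toEmbedding
  have h1 : R.law id A = Q.law g A := by rw [hf, hQ.law_eq f g]
  rw [law, law, Measure.map_apply (R.measurable_restrict id) hAm,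
    Measure.map_apply (Q.measurable_restrict g) hAm] at h1
  rw [measureReal_def, measureReal_def]
  congr 1
  convert h1 using 2
  · ext ω
    exact basicSojourn_le_iff hm j ω t
  · ext ω
    simp only [hA, Set.mem_ofPred_eq, Set.mem_preimage]
    have hfc : ∀ l, finish (fun l => Q.interarrival l ω) (fun j i => Q.service j (g i) ω) j l =
        finish (fun l => Q.interarrival l ω) (fun l i => Q.service l i ω) j (g l) :=
      finish_comp _ (fun l i => Q.service l i ω) g j
    simp only [hfc]
    have hrange : ∀ x, x ∈ I ↔ ∃ l, g l = x := by
      intro x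
      have := Finset.range_orderEmbOfFin I hI
      exact (Finset.mem_coe.symm.trans (this ▸ Iff.rfl))
    simp only [hrange, forall_exists_index, forall_apply_eq_imp_iff]

/-! ### Stable laws -/

theorem measurable_basicSojourn (R : Input.{v} m) (j : ℕ) : Measurable (R.basicSojourn j) :=
  have hf : ∀ l, Measurable fun ω =>
      finish (fun l => R.interarrival l ω) (fun l i => R.service l i ω) j l := fun l =>
    (measurable_pi_apply l).comp ((measurable_finish j).comp (R.measurable_restrict id))
  (Measurable.iSup hf).sub ((measurable_arrival j).comp (R.measurable_restrict id))

theorem measurable_nonPurgingSojourn (Q : Input.{u} n) {k : ℕ} (hk : 1 ≤ k) (hkn : k ≤ n) (j : ℕ) :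
    Measurable (Q.nonPurgingSojourn k j) :=
  ((measurable_orderStat hk hkn).comp
    ((measurable_finish j).comp (Q.measurable_restrict id))).sub
    ((measurable_arrival j).comp (Q.measurable_restrict id))

theorem measurable_purgingSojourn (Q : Input.{u} n) {k : ℕ} (hk : 1 ≤ k) (hkn : k ≤ n) (j : ℕ) :
    Measurable (Q.purgingSojourn k j) :=
  ((measurable_orderStat hk hkn).comp
    ((measurable_purgingFinish hk hkn j).comp (Q.measurable_restrict id))).sub
    ((measurable_arrival j).comp (Q.measurable_restrict id))

/-- The distribution of a real random variable on the sample space of a queue. -/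
noncomputable def distribution (Q : Input.{u} n) (X : Q.Ω → ℝ) (hX : Measurable X) :
    ProbabilityMeasure ℝ :=
  ⟨Q.P.map X, Measure.isProbabilityMeasure_map hX.aemeasurable⟩

theorem distribution_apply (Q : Input.{u} n) {X : Q.Ω → ℝ} (hX : Measurable X) {s : Set ℝ}
    (hs : MeasurableSet s) : (Q.distribution X hX : Measure ℝ) s = Q.P (X ⁻¹' s) :=
  Measure.map_apply hX hs

theorem distribution_real_apply (Q : Input.{u} n) {X : Q.Ω → ℝ} (hX : Measurable X) {s : Set ℝ}
    (hs : MeasurableSet s) : (Q.distribution X hX : Measure ℝ).real s = Q.P.real (X ⁻¹' s) := by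
  rw [measureReal_def, measureReal_def, distribution_apply Q hX hs]

theorem hasStableLaw_iff (Q : Input.{u} n) {X : ℕ → Q.Ω → ℝ} (hX : ∀ j, Measurable (X j))
    (ν : ProbabilityMeasure ℝ) :
    Q.HasStableLaw X ν ↔ Tendsto (fun j => Q.distribution (X j) (hX j)) atTop (𝓝 ν) := by
  have hν : (⟨(ν : Measure ℝ).map id, Measure.isProbabilityMeasure_map aemeasurable_id⟩ :
      ProbabilityMeasure ℝ) = ν := Subtype.ext Measure.map_id
  constructor
  · intro h
    have := h.tendsto
    rw [hν] at this
    exact this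
  · intro h
    refine ⟨fun j => (hX j).aemeasurable, aemeasurable_id, ?_⟩
    rw [hν]
    exact h

theorem measureReal_nonPurgingSojourn_le {Q : Input.{u} n} (hQ : Q.Homogeneous) {k : ℕ}
    (hk : 1 ≤ k) (hkn : k ≤ n) {B : (i : ℕ) → Input.{v} i}
    (hB : ∀ i ∈ Finset.Icc k n, (B i).Equivalent Q) (j : ℕ) (t : ℝ) :
    Q.P.real {ω | Q.nonPurgingSojourn k j ω ≤ t} =
      ∑ i ∈ Finset.Icc k n, (coeffW n k i : ℝ) * (B i).P.real {ω | (B i).basicSojourn j ω ≤ t} := by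
  set X : Q.Ω → Fin n → ℝ := fun ω i => finish (fun l => Q.interarrival l ω)
    (fun l i => Q.service l i ω) j i - arrival (fun l => Q.interarrival l ω) j with hX
  have hXm : ∀ i, Measurable fun ω => X ω i := fun i =>
    ((measurable_pi_apply i).comp ((measurable_finish j).comp (Q.measurable_restrict id))).sub
      ((measurable_arrival j).comp (Q.measurable_restrict id))
  have hIm : ∀ I : Finset (Fin n), MeasurableSet {ω | ∀ l ∈ I, X ω l ≤ t} := by
    intro I
    have : {ω | ∀ l ∈ I, X ω l ≤ t} = ⋂ l ∈ I, {ω | X ω l ≤ t} := by ext ω; simp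
    rw [this]
    exact Finset.measurableSet_biInter _ fun l _ => measurableSet_le (hXm l) measurable_const
  have hind : ∀ (s : Set Q.Ω), MeasurableSet s → ∫ ω, s.indicator (1 : Q.Ω → ℝ) ω ∂Q.P =
      Q.P.real s := fun s hs => integral_indicator_one hs
  have hpt : ∀ ω, {ω | Q.nonPurgingSojourn k j ω ≤ t}.indicator (1 : Q.Ω → ℝ) ω =
      ∑ i ∈ Finset.Icc k n, ∑ I ∈ Finset.powersetCard i (Finset.univ : Finset (Fin n)),
        (subsetWeight k i : ℝ) * {ω | ∀ l ∈ I, X ω l ≤ t}.indicator (1 : Q.Ω → ℝ) ω := by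
    intro ω
    have h := ite_le_card_filter_eq (k := k) (fun i => X ω i ≤ t)
    simp only [Set.indicator_apply, Set.mem_ofPred_eq, Pi.one_apply]
    rw [← h]
    congr 1
    rw [nonPurgingSojourn, sub_le_iff_le_add, orderStat_le_iff hk hkn]
    simp only [hX, sub_le_iff_le_add]
  have hint : ∀ I : Finset (Fin n), ∀ c : ℝ, Integrable (fun ω => c *
      {ω | ∀ l ∈ I, X ω l ≤ t}.indicator (1 : Q.Ω → ℝ) ω) Q.P := fun I c =>
    ((integrable_const (1 : ℝ)).indicator (hIm I)).const_mul c
  rw [← hind _ (measurableSet_le (Q.measurable_nonPurgingSojourn hk hkn j) measurable_const)]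
  simp only [hpt]
  rw [integral_finsetSum _ fun i _ => integrable_finsetSum _ fun I _ => hint I _]
  refine Finset.sum_congr rfl fun i hi => ?_
  obtain ⟨hki, hin⟩ := Finset.mem_Icc.1 hi
  rw [integral_finsetSum _ fun I _ => hint I _]
  have hterm : ∀ I ∈ Finset.powersetCard i (Finset.univ : Finset (Fin n)),
      ∫ ω, (subsetWeight k i : ℝ) * {ω | ∀ l ∈ I, X ω l ≤ t}.indicator (1 : Q.Ω → ℝ) ω ∂Q.P =
        (subsetWeight k i : ℝ) * (B i).P.real {ω | (B i).basicSojourn j ω ≤ t} := by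
    intro I hI
    rw [integral_const_mul, hind _ (hIm I), measureReal_basicSojourn_le hQ (hB i hi)
      (hk.trans hki) j t I (Finset.mem_powersetCard.1 hI).2]
  rw [Finset.sum_congr rfl hterm, Finset.sum_const, Finset.card_powersetCard, Finset.card_univ,
    Fintype.card_fin, coeffW_eq n k i hin, nsmul_eq_mul]
  push_cast
  ring

theorem purgingSojourn_le_nonPurgingSojourn (Q : Input.{u} n) {k : ℕ} (hk : 1 ≤ k) (hkn : k ≤ n)
    (j : ℕ) (ω : Q.Ω) : Q.purgingSojourn k j ω ≤ Q.nonPurgingSojourn k j ω :=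
  sub_le_sub_right (orderStat_mono hk hkn fun i => purgingFinish_le_finish k _ _ j i) _

theorem purgingSojourn_nonneg (Q : Input.{u} n) {k : ℕ} (hk : 1 ≤ k) (hkn : k ≤ n) (j : ℕ) :
    ∀ᵐ ω ∂Q.P, 0 ≤ Q.purgingSojourn k j ω := by
  filter_upwards [ae_all_iff.2 fun j => ae_all_iff.2 fun i => Q.service_nonneg j i] with ω hω
  exact sub_nonneg.2 (le_orderStat hk hkn fun i => arrival_le_purgingFinish k _ _ hω j i)

theorem ae_nonneg_distribution (Q : Input.{u} n) {X : Q.Ω → ℝ} (hX : Measurable X)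
    (h : ∀ᵐ ω ∂Q.P, 0 ≤ X ω) : ∀ᵐ x ∂(Q.distribution X hX : Measure ℝ), 0 ≤ x :=
  (ae_map_iff hX.aemeasurable measurableSet_Ici).2 h

/-- After deletion of job `0`, job `j + 1` becomes job `j` of an input with the same law, and on
each path its sojourn time does not grow. -/
theorem Stationary.measure_purgingSojourn_le {Q : Input.{u} n} (hS : Q.Stationary) {k : ℕ}
    (hk : 1 ≤ k) (hkn : k ≤ n) (j : ℕ) (t : ℝ) :
    Q.P {ω | Q.purgingSojourn k (j + 1) ω ≤ t} ≤ Q.P {ω | Q.purgingSojourn k j ω ≤ t} := by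
  have hA : MeasurableSet {p : (ℕ → ℝ) × (ℕ → Fin n → ℝ) | purgingSojournPath k j p ≤ t} :=
    measurableSet_le (measurable_purgingSojournPath hk hkn j) measurable_const
  have hsm : Measurable fun ω => ((fun j => Q.interarrival (j + 1) ω,
      fun j i => Q.service (j + 1) i ω) : (ℕ → ℝ) × (ℕ → Fin n → ℝ)) :=
    (measurable_pi_lambda _ fun j => Q.measurable_interarrival (j + 1)).prodMk
      (measurable_pi_lambda _ fun j => measurable_pi_lambda _ fun i =>
        Q.measurable_service (j + 1) i)
  have h := congrArg (fun μ : Measure _ => μ {p | purgingSojournPath k j p ≤ t}) hS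
  rw [law, Measure.map_apply hsm hA, Measure.map_apply (Q.measurable_restrict id) hA] at h
  refine le_trans (measure_mono fun ω hω => ?_) h.le
  exact (purgingSojournPath_shift_le hk hkn j
    (fun l => Q.interarrival l ω, fun l i => Q.service l i ω)).trans hω

end Input

end ForkJoin

theorem theorem7 (n k : ℕ) (hk : 1 ≤ k) (hkn : k ≤ n)
    -- the common input of the purging and the non-purging `(n,k)` queue
    (Q : ForkJoin.Input n) (hQ : Q.Homogeneous)
    -- the equivalent basic `(i,i)` queues, with stable sojourn times of finite expectation
    (B : (i : ℕ) → ForkJoin.Input i)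
    (hB : ∀ i ∈ Finset.Icc k n, (B i).Equivalent Q)
    (β : ℕ → ProbabilityMeasure ℝ)
    (hβ : ∀ i ∈ Finset.Icc k n, (B i).HasStableLaw (B i).basicSojourn (β i))
    (hβ_int : ∀ i ∈ Finset.Icc k n, Integrable (fun x : ℝ => x) (β i : Measure ℝ)) :
    -- the sum is the expected sojourn time of the non-purging queue
    (∃ ν : ProbabilityMeasure ℝ, Q.HasStableLaw (Q.nonPurgingSojourn k) ν ∧
      Integrable (fun x : ℝ => x) (ν : Measure ℝ) ∧
      ∫ x, x ∂(ν : Measure ℝ) =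
        ∑ i ∈ Finset.Icc k n, (ForkJoin.coeffW n k i : ℝ) * ∫ x, x ∂(β i : Measure ℝ)) ∧
    -- and it bounds the expected sojourn time of the purging queue
    (∀ π : ProbabilityMeasure ℝ, Q.HasStableLaw (Q.purgingSojourn k) π →
      Integrable (fun x : ℝ => x) (π : Measure ℝ) ∧
      ∫ x, x ∂(π : Measure ℝ) ≤
        ∑ i ∈ Finset.Icc k n, (ForkJoin.coeffW n k i : ℝ) * ∫ x, x ∂(β i : Measure ℝ)) ∧
    -- the purging queue has a stable sojourn time whenever the input is stationary
    (Q.Stationary → ∃ π : ProbabilityMeasure ℝ, Q.HasStableLaw (Q.purgingSojourn k) π) := by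
  have hmB : ∀ i j, Measurable ((B i).basicSojourn j) := fun i => (B i).measurable_basicSojourn
  have hmN := fun j => Q.measurable_nonPurgingSojourn hk hkn j
  have hmP := fun j => Q.measurable_purgingSojourn hk hkn j
  obtain ⟨ν, hν, hνf⟩ := ForkJoin.exists_tendsto_of_linear_combination (Finset.Icc k n)
    (ForkJoin.coeffW n k) (fun j => Q.distribution _ (hmN j))
    (fun i j => (B i).distribution _ (hmB i j)) β
    (fun i hi => ((B i).hasStableLaw_iff (hmB i) (β i)).1 (hβ i hi))
    (fun j t => by
      simp only [ForkJoin.Input.distribution_real_apply _ _ measurableSet_Iic]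
      exact ForkJoin.Input.measureReal_nonPurgingSojourn_le hQ hk hkn hB j t)
  obtain ⟨hνi, hνm⟩ := hνf (fun x => x) hβ_int
  refine ⟨⟨ν, (Q.hasStableLaw_iff hmN ν).2 hν, hνi, hνm⟩, fun π hπ => ?_, fun hS => ?_⟩
  · rw [← hνm]
    refine ForkJoin.integrable_and_integral_le_of_tendsto ((Q.hasStableLaw_iff hmP π).1 hπ) hν
      (fun j t => ?_) (fun j => Q.ae_nonneg_distribution _ (Q.purgingSojourn_nonneg hk hkn j))
      (fun j => Q.ae_nonneg_distribution _ ?_) hνi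
    · rw [Q.distribution_apply _ measurableSet_Ioi, Q.distribution_apply _ measurableSet_Ioi]
      exact measure_mono fun ω hω =>
        lt_of_lt_of_le hω (Q.purgingSojourn_le_nonPurgingSojourn hk hkn j ω)
    · filter_upwards [Q.purgingSojourn_nonneg hk hkn j] with ω hω
      exact hω.trans (Q.purgingSojourn_le_nonPurgingSojourn hk hkn j ω)
  · obtain ⟨π, hπ⟩ := ForkJoin.exists_tendsto_of_antitone_cdf
      (π := fun j => Q.distribution _ (hmP j)) hν
      (fun t => antitone_nat_of_succ_le fun j => by
        rw [Q.distribution_real_apply _ measurableSet_Iic,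
          Q.distribution_real_apply _ measurableSet_Iic]
        exact ENNReal.toReal_mono (measure_ne_top _ _)
          (hS.measure_purgingSojourn_le hk hkn j t))
      (fun j t => by
        rw [Q.distribution_apply _ measurableSet_Iic, Q.distribution_apply _ measurableSet_Iic]
        exact measure_mono fun ω hω =>
          (Q.purgingSojourn_le_nonPurgingSojourn hk hkn j ω).trans hω)
    exact ⟨π, (Q.hasStableLaw_iff hmP π).2 hπ⟩
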